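/- Let $\mathfrak S=\bigcup_n S_n$ be the set of all finite permutations and write $|\sigma|$ for the order $n$ of $\sigma\in S_n$. For $\pi\in S_k$ and $\sigma\in S_n$ with $k\le n$, the density $t(\pi,\sigma)$ is $\binom nk^{-1}$ times the number of strictly increasing maps $g:[k]\to[n]$ such that, for all $i,j\in[k]$, $\pi(i)>\pi(j)$ if and only if $\sigma(g(i))>\sigma(g(j))$; if $k>n$, then $t(\pi,\sigma)=0$. A permutation parameter is a function $f:\mathfrak S\to\mathbb R$. It is - finitely forcible if there is a finite set $\mathcal A\subset\mathfrak S$ such that for every $\varepsilon>0$ there are $n_0\in\mathbb N$ and $\delta>0$ such that $|f(\sigma)-f(\pi)|<\varepsilon$ whenever $|\sigma|,|\pi|\ge n_0$ and $|t(\tau,\sigma)-t(\tau,\pi)|<\delta$ for all $\tau\in\mathcal A$; - finitely approximable if for every $\varepsilon>0$ there are $\delta>0$, $n_0\in\mathbb N$ and a finite set $\mathcal A_\varepsilon\subset\mathfrak S$ such that $|f(\sigma)-f(\pi)|<\varepsilon$ whenever $|\sigma|,|\pi|\ge n_0$ and $|t(\tau,\sigma)-t(\tau,\pi)|<\delta$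 for all $\tau\in\mathcal A_\varepsilon$; - testable if for every $\varepsilon>0$ there are $n_0\in\mathbb N$ and $\tilde f:S_{n_0}\to\mathbb R$ such that for every $\sigma$ with $|\sigma|\ge n_0$, a uniformly random subpermutation $\pi$ of $\sigma$ of order $n_0$ satisfies $|f(\sigma)-\tilde f(\pi)|<\varepsilon$ with probability at least $1-\varepsilon$. **Theorem 2.** There exists a bounded permutation parameter $f$ that is finitely approximable and testable, but not finitely forcible. -/

import Mathlib

namespace PermTesting

/-- A permutation of some finite order `n`, acting on `Fin n` (the set `[n]` shifted to start
at `0`). -/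
abbrev Permutation : Type := Σ n : ℕ, Equiv.Perm (Fin n)

/-- The order `|σ|` of a permutation. -/
def Permutation.order (σ : Permutation) : ℕ := σ.1

/-- `IsOcc π σ g`: the map `g : [k] → [n]` is an occurrence of the permutation `π` of order `k` in
the permutation `σ` of order `n`: it is strictly increasing, and `π i > π j` if and only if
`σ (g i) > σ (g j)`. In other words, the index set `g([k])` induces the subpermutation `π` in
`σ`. -/
def IsOcc {k n : ℕ} (π : Equiv.Perm (Fin k)) (σ : Equiv.Perm (Fin n)) (g : Fin k → Fin n) : Prop :=
  StrictMono g ∧ ∀ i j : Fin k, π i > π j ↔ σ (g i) > σ (g j)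

open Classical in
/-- The set of all occurrences of `π` in `σ`. -/
noncomputable def Occ (π σ : Permutation) : Finset (Fin π.1 → Fin σ.1) :=
  Finset.univ.filter (fun g => IsOcc π.2 σ.2 g)

/-- The density `t(π, σ)` of `π` in `σ`. -/
noncomputable def density (π σ : Permutation) : ℝ :=
  if π.order ≤ σ.order then ((Occ π σ).card : ℝ) / (σ.order.choose π.order : ℝ) else 0

/-- A permutation parameter is a real-valued function on the set of all permutations. -/
abbrev PermParam : Type := Permutation → ℝ

/-- The parameter `f` is a bounded function. -/
def IsBounded (f : PermParam) : Prop :=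
  ∃ C : ℝ, ∀ σ : Permutation, |f σ| ≤ C

/-- `A` is a forcing family for `f`. -/
def IsForcingFamily (A : Finset Permutation) (f : PermParam) : Prop :=
  ∀ ε : ℝ, 0 < ε → ∃ n₀ : ℕ, ∃ δ : ℝ, 0 < δ ∧
    ∀ σ π : Permutation, n₀ ≤ σ.order → n₀ ≤ π.order →
      (∀ τ ∈ A, |density τ σ - density τ π| < δ) → |f σ - f π| < ε

/-- `f` is finitely forcible: one finite family of permutations works for every `ε`. -/
def FinitelyForcible (f : PermParam) : Prop :=
  ∃ A : Finset Permutation, IsForcingFamily A f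

/-- `f` is finitely approximable: the finite family of permutations may depend on `ε`. -/
def FinitelyApproximable (f : PermParam) : Prop :=
  ∀ ε : ℝ, 0 < ε → ∃ δ : ℝ, 0 < δ ∧ ∃ n₀ : ℕ, ∃ A : Finset Permutation,
    ∀ σ π : Permutation, n₀ ≤ σ.order → n₀ ≤ π.order →
      (∀ τ ∈ A, |density τ σ - density τ π| < δ) → |f σ - f π| < ε

open Classical in
/-- The probability that a uniformly random subpermutation of `σ` of order `m ≤ |σ|` has the
property `P`: an `m`-element set of indices of `σ` (the range of exactly one strictly increasing
map `g`) is chosen uniformly among all `|σ|.choose m` such sets, and `P` is tested on the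
permutation of order `m` that it induces. -/
noncomputable def sampleProb (σ : Permutation) (m : ℕ) (P : Equiv.Perm (Fin m) → Prop) : ℝ :=
  ((Finset.univ.filter (fun g : Fin m → Fin σ.1 =>
      ∃ π : Equiv.Perm (Fin m), IsOcc π σ.2 g ∧ P π)).card : ℝ) / (σ.order.choose m : ℝ)

/-- `f` is testable: it can be estimated from a random subpermutation of bounded order. -/
def Testable (f : PermParam) : Prop :=
  ∀ ε : ℝ, 0 < ε → ∃ n₀ : ℕ, ∃ f' : Equiv.Perm (Fin n₀) → ℝ,
    ∀ σ : Permutation, n₀ ≤ σ.order →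
      1 - ε ≤ sampleProb σ n₀ (fun π => |f σ - f' π| < ε)

end PermTesting

/-!
The parameter is `f = ∑ j, w j * t(τ j, ·)` for a sequence of patterns `τ j` of increasing order and
rapidly decreasing positive weights `w j`.

A uniform limit of finite linear combinations of densities is finitely approximable. It is also
testable: the density of `τ` in a random sample of order `m` has mean `t(τ, σ)`, and its variance is
small because two random `k`-subsets of a large set are disjoint with high probability, and disjoint
pairs are nearly independent (`sum_sq_deviation_le`). Markov's inequality for `|f σ - f π|`, with `π`
the sample, gives testability (`UniformlyApproximated.testable`).

The patterns are chosen to defeat every finite forcing family. There are `n!` permutations of order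
`n`, but only exponentially many possible lists of counts of the patterns of order at most `k`, so
for large `n` two different permutations `σ`, `π` of order `n` have the same counts
(`exists_ne_card_Occ_eq`). Let `τ` be a smallest pattern whose counts in `σ` and `π` differ. Replacing
each point by an increasing run of `N` points keeps the counts of all patterns smaller than `τ` equal
and multiplies the difference of the counts of `τ` by `N ^ |τ|` (`card_Occ_inflate_congr`), so the
densities of `τ` in the inflations differ by a constant independent of `N` (`exists_separates`).
Iterating gives the sequence `τ j`. On the pairs that belong to `τ j`, all smaller patterns have equal
densities, whereas `f` differs by a fixed amount, since the weights after `w j` are too small to cancel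
the `j`-th term (`le_abs_weightedParam_sub`).
-/

namespace PermTesting

open Finset Filter

/-! ### Patterns and occurrences as index sets -/

/-- The standardization of `u : Fin m → Fin n`: for injective `u`, the permutation of `Fin m` whose
values are ordered in the same way as those of `u`. The sample of `σ` along `g` is
`pattern (σ ∘ g)`. For `u` with repeated values the ties are broken by position. -/
noncomputable def pattern {m n : ℕ} (u : Fin m → Fin n) : Equiv.Perm (Fin m) :=
  (Tuple.sort u)⁻¹

lemma pattern_lt_pattern {m n : ℕ} {u : Fin m → Fin n} (hu : Function.Injective u) (i j : Fin m) :
    pattern u i < pattern u j ↔ u i < u j := by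
  have hs : StrictMono (u ∘ Tuple.sort u) :=
    (Tuple.monotone_sort u).strictMono_of_injective (hu.comp (Equiv.injective _))
  have h := hs.lt_iff_lt (a := pattern u i) (b := pattern u j)
  simpa [pattern] using h.symm

lemma perm_eq_of_lt_iff {m : ℕ} {ρ ρ' : Equiv.Perm (Fin m)}
    (h : ∀ i j, ρ i < ρ j ↔ ρ' i < ρ' j) : ρ = ρ' := by
  have hs : StrictMono (ρ' ∘ ρ.symm) := fun a b hab => (h _ _).1 (by simpa)
  have hid : ρ' ∘ ρ.symm = id :=
    (hs.range_inj strictMono_id).1 (by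
      rw [(ρ'.surjective.comp ρ.symm.surjective).range_eq, Set.range_id])
  ext i
  have := congrFun hid (ρ i)
  simp at this
  rw [this]

lemma isOcc_iff {m n : ℕ} {ρ : Equiv.Perm (Fin m)} {σ : Equiv.Perm (Fin n)} {g : Fin m → Fin n} :
    IsOcc ρ σ g ↔ StrictMono g ∧ ρ = pattern (σ ∘ g) := by
  refine and_congr_right fun hg => ?_
  have hinj : Function.Injective (σ ∘ g) := σ.injective.comp hg.injective
  constructor
  · intro h
    exact perm_eq_of_lt_iff fun i j => by rw [pattern_lt_pattern hinj]; exact h j i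
  · rintro rfl i j
    exact pattern_lt_pattern hinj j i

lemma isOcc_pattern_iff {k m n : ℕ} {τ : Equiv.Perm (Fin k)} {σ : Equiv.Perm (Fin n)}
    {g : Fin m → Fin n} (hg : StrictMono g) {h : Fin k → Fin m} :
    IsOcc τ (pattern (σ ∘ g)) h ↔ IsOcc τ σ (g ∘ h) := by
  have hinj : Function.Injective (σ ∘ g) := σ.injective.comp hg.injective
  refine and_congr ⟨fun hh => hg.comp hh, fun hh a b hab => hg.lt_iff_lt.1 (hh hab)⟩ ?_
  simp only [gt_iff_lt, pattern_lt_pattern hinj, Function.comp_apply]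

open Classical in
/-- The strictly increasing maps `Fin m → Fin n`, in bijection with the `m`-subsets of `Fin n`. -/
noncomputable def strictMonos (m n : ℕ) : Finset (Fin m → Fin n) :=
  univ.filter StrictMono

lemma mem_strictMonos {m n : ℕ} {g : Fin m → Fin n} : g ∈ strictMonos m n ↔ StrictMono g := by
  simp [strictMonos]

lemma image_injOn_strictMonos (m n : ℕ) :
    Set.InjOn (fun g : Fin m → Fin n => univ.image g) (strictMonos m n) := by
  intro g hg g' hg' h
  simp only [mem_coe, mem_strictMonos] at hg hg'
  refine (hg.range_inj hg').1 ?_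
  have := congrArg (fun s : Finset (Fin n) => (s : Set (Fin n))) h
  simpa using this

lemma image_strictMonos (m n : ℕ) :
    (strictMonos m n).image (fun g : Fin m → Fin n => univ.image g) =
      powersetCard m (univ : Finset (Fin n)) := by
  ext S
  simp only [mem_image, mem_strictMonos, mem_powersetCard_univ]
  constructor
  · rintro ⟨g, hg, rfl⟩
    rw [card_image_of_injective _ hg.injective, card_univ, Fintype.card_fin]
  · intro hS
    refine ⟨S.orderEmbOfFin hS, (S.orderEmbOfFin hS).strictMono, ?_⟩
    exact S.image_orderEmbOfFin_univ hS

lemma card_strictMonos (m n : ℕ) : (strictMonos m n).card = n.choose m := by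
  rw [← card_image_of_injOn (image_injOn_strictMonos m n), image_strictMonos, card_powersetCard,
    card_univ, Fintype.card_fin]

lemma mem_Occ {τ σ : Permutation} {g : Fin τ.1 → Fin σ.1} : g ∈ Occ τ σ ↔ IsOcc τ.2 σ.2 g := by
  simp [Occ]

lemma mem_Occ_mk {k n : ℕ} {τ : Equiv.Perm (Fin k)} {σ : Equiv.Perm (Fin n)}
    {g : Fin k → Fin n} : g ∈ Occ ⟨k, τ⟩ ⟨n, σ⟩ ↔ IsOcc τ σ g :=
  mem_Occ

lemma Occ_subset (τ σ : Permutation) : Occ τ σ ⊆ strictMonos τ.1 σ.1 :=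
  fun _ hg => mem_strictMonos.2 (mem_Occ.1 hg).1

lemma card_Occ_le (τ σ : Permutation) : (Occ τ σ).card ≤ σ.order.choose τ.order :=
  (card_le_card (Occ_subset τ σ)).trans (card_strictMonos _ _).le

/-- The case distinction in `density` is redundant: `n.choose k = 0` for `k > n`, and `x / 0 = 0`. -/
lemma density_eq (τ σ : Permutation) :
    density τ σ = ((Occ τ σ).card : ℝ) / (σ.order.choose τ.order : ℝ) := by
  unfold density
  split_ifs with h
  · rfl
  · rw [Nat.choose_eq_zero_of_lt (not_le.1 h)]; simp

lemma density_nonneg (τ σ : Permutation) : 0 ≤ density τ σ := by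
  rw [density_eq]; positivity

lemma density_le_one (τ σ : Permutation) : density τ σ ≤ 1 := by
  rw [density_eq]
  exact div_le_one_of_le₀ (by exact_mod_cast card_Occ_le τ σ) (by positivity)

/-- The index sets of the occurrences of `τ` in `σ`; each determines its occurrence. -/
noncomputable def occSets (τ σ : Permutation) : Finset (Finset (Fin σ.1)) :=
  (Occ τ σ).image fun g => univ.image g

lemma card_occSets (τ σ : Permutation) : (occSets τ σ).card = (Occ τ σ).card :=
  card_image_of_injOn ((image_injOn_strictMonos _ _).mono (by exact_mod_cast Occ_subset τ σ))

lemma occSets_subset (τ σ : Permutation) : occSets τ σ ⊆ powersetCard τ.1 univ := by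
  rw [← image_strictMonos]
  exact image_subset_image (Occ_subset τ σ)

/-- The occurrences of `τ` in the sample of `σ` along `g` are the occurrences of `τ` in `σ` whose
index set lies in the sampled set. -/
lemma card_Occ_pattern (τ σ : Permutation) {m : ℕ} {g : Fin m → Fin σ.1} (hg : StrictMono g) :
    (Occ τ ⟨m, pattern (σ.2 ∘ g)⟩).card =
      ((occSets τ σ).filter (· ⊆ univ.image g)).card := by
  refine card_bij (fun h _ => univ.image (g ∘ h)) ?_ ?_ ?_
  · intro h hh
    rw [mem_Occ, isOcc_pattern_iff hg] at hh
    refine mem_filter.2 ⟨mem_image.2 ⟨g ∘ h, mem_Occ.2 hh, rfl⟩, ?_⟩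
    rw [← image_image]
    exact image_subset_image (subset_univ _)
  · intro h hh h' hh' heq
    rw [mem_Occ, isOcc_pattern_iff hg] at hh hh'
    have := image_injOn_strictMonos _ _ (mem_strictMonos.2 hh.1) (mem_strictMonos.2 hh'.1) heq
    funext i
    exact hg.injective (congrFun this i)
  · intro K hK
    obtain ⟨hK, hsub⟩ := mem_filter.1 hK
    obtain ⟨u, hu, rfl⟩ := mem_image.1 hK
    have : ∀ i, ∃ j, g j = u i := fun i => by
      simpa using hsub (mem_image_of_mem u (mem_univ i))
    choose h hh using this
    obtain rfl : g ∘ h = u := funext hh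
    exact ⟨h, by rw [mem_Occ, isOcc_pattern_iff hg]; exact mem_Occ.1 hu, rfl⟩

/-! ### Second moment of a sampled density -/

/-- The arithmetic behind `sum_sq_deviation_le`. There `a`, `b`, `c`, `e`, `f` stand for the
binomial coefficients `C(n, m)`, `C(m, k)`, `C(m - k, k)`, `C(n, k)`, `C(n - k, k)`, while `g`, `h`
are `C(n - k, m - k)`, `C(n - 2k, m - 2k)`, `o` is the size of the family and `s` the sum of the
squared counts. -/
lemma second_moment_bound {a b c e f g h o s : ℝ} (ha : 0 < a) (hb : 0 < b) (he : 0 < e)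
    (hf : 0 < f) (hcb : c ≤ b) (hfe : f ≤ e) (ho : 0 ≤ o) (hoe : o ≤ e)
    (h1 : a * b = e * g) (h2 : g * c = f * h)
    (hs : s ≤ o ^ 2 * h + a * (b ^ 2 - b * c)) :
    s / b ^ 2 - a * (o / e) ^ 2 ≤ a * (((f / e)⁻¹ - 1) + (1 - c / b)) := by
  obtain rfl : g = a * b / e := by field_simp; linarith
  obtain rfl : h = a * b / e * c / f := by field_simp at h2 ⊢; linarith
  obtain ⟨t, rfl⟩ : ∃ t, o = t * e := ⟨o / e, by field_simp⟩
  have hte : t * e / e = t := by field_simp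
  have ht0 : 0 ≤ t := nonneg_of_mul_nonneg_left ho he
  have ht1 : t ≤ 1 := le_of_mul_le_mul_right (by linarith) he
  have hs' : s / b ^ 2 ≤ a * (t ^ 2 * (c / b * (e / f)) + (1 - c / b)) := by
    rw [div_le_iff₀ (by positivity)]
    refine hs.trans (le_of_eq ?_)
    field_simp
  rw [hte, inv_div]
  have hr1 : 1 ≤ e / f := (one_le_div hf).2 hfe
  have hq : c / b * (e / f) ≤ e / f :=
    mul_le_of_le_one_left (by positivity) (div_le_one_of_le₀ hcb hb.le)
  have key : t ^ 2 * (c / b * (e / f)) - t ^ 2 ≤ e / f - 1 := by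
    have : t ^ 2 ≤ 1 := pow_le_one₀ ht0 ht1
    nlinarith [mul_le_mul_of_nonneg_left hq (sq_nonneg t)]
  nlinarith [mul_le_mul_of_nonneg_left key ha.le]

section SetFamilies

variable {n k m : ℕ} {𝒪 : Finset (Finset (Fin n))}

lemma card_filter_superset (U : Finset (Fin n)) (hU : U.card ≤ m) :
    ((powersetCard m univ).filter (U ⊆ ·)).card = (n - U.card).choose (m - U.card) := by
  rw [card_filter_powersetCard_subset U univ m (subset_univ U) hU, card_univ, Fintype.card_fin]

lemma sum_card_filter_subset (h𝒪 : 𝒪 ⊆ powersetCard k univ) (hkm : k ≤ m) :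
    ∑ S ∈ powersetCard m univ, (𝒪.filter (· ⊆ S)).card =
      𝒪.card * (n - k).choose (m - k) := by
  have h := sum_card_bipartiteAbove_eq_sum_card_bipartiteBelow (s := 𝒪)
    (t := powersetCard m (univ : Finset (Fin n))) (fun K S => K ⊆ S)
  unfold bipartiteAbove bipartiteBelow at h
  rw [← h, sum_const_nat]
  intro K hK
  have hc : K.card = k := mem_powersetCard_univ.1 (h𝒪 hK)
  rw [card_filter_superset K (by omega), hc]

lemma card_filter_disjoint (S : Finset (Fin n)) (hS : S.card = m) :
    ((powersetCard k S ×ˢ powersetCard k S).filter fun p => Disjoint p.1 p.2).card =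
      m.choose k * (m - k).choose k := by
  have hsig : ((powersetCard k S ×ˢ powersetCard k S).filter fun p => Disjoint p.1 p.2).card =
      ((powersetCard k S).sigma fun K => powersetCard k (S \ K)).card := by
    refine card_bij (fun p _ => ⟨p.1, p.2⟩) ?_ ?_ ?_
    · rintro ⟨K, K'⟩ h
      simp only [mem_filter, mem_product, mem_powersetCard, mem_sigma, subset_sdiff] at h ⊢
      exact ⟨h.1.1, ⟨h.1.2.1, h.2.symm⟩, h.1.2.2⟩
    · rintro ⟨K, K'⟩ - ⟨L, L'⟩ - h
      simpa using h
    · rintro ⟨K, K'⟩ h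
      simp only [mem_sigma, mem_powersetCard, subset_sdiff] at h
      refine ⟨(K, K'), ?_, rfl⟩
      simp only [mem_filter, mem_product, mem_powersetCard]
      exact ⟨⟨h.1, h.2.1.1, h.2.2⟩, h.2.1.2.symm⟩
  rw [hsig, card_sigma, sum_const_nat (m := (m - k).choose k), card_powersetCard, hS]
  intro K hK
  obtain ⟨hKS, hK⟩ := mem_powersetCard.1 hK
  rw [card_powersetCard, card_sdiff_of_subset hKS, hS, hK]

/-- Squares count pairs of members of `𝒪` inside `S`. Disjoint pairs are counted by the sets `S` that
contain their union; for intersecting pairs the trivial bound, all intersecting pairs of `k`-subsets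
of `S`, is enough. -/
lemma sum_sq_card_filter_subset_le (h𝒪 : 𝒪 ⊆ powersetCard k univ) (hkm : 2 * k ≤ m) :
    ∑ S ∈ powersetCard m univ, (𝒪.filter (· ⊆ S)).card ^ 2 ≤
      𝒪.card ^ 2 * (n - 2 * k).choose (m - 2 * k) +
        n.choose m * (m.choose k ^ 2 - m.choose k * (m - k).choose k) := by
  classical
  have hsplit : ∀ S ∈ powersetCard m (univ : Finset (Fin n)), (𝒪.filter (· ⊆ S)).card ^ 2 ≤
      (((𝒪 ×ˢ 𝒪).filter fun p => Disjoint p.1 p.2).filter fun p => p.1 ∪ p.2 ⊆ S).card +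
        (m.choose k ^ 2 - m.choose k * (m - k).choose k) := by
    intro S hS
    rw [mem_powersetCard_univ] at hS
    rw [sq, ← card_product,
      ← card_filter_add_card_filter_not (s := 𝒪.filter (· ⊆ S) ×ˢ 𝒪.filter (· ⊆ S))
        (fun p => Disjoint p.1 p.2)]
    refine add_le_add (card_le_card ?_) ?_
    · rintro ⟨K, K'⟩ h
      simp only [mem_filter, mem_product, union_subset_iff] at h ⊢
      tauto
    · have htot := card_filter_add_card_filter_not (s := powersetCard k S ×ˢ powersetCard k S)
        (fun p => Disjoint p.1 p.2)
      rw [card_filter_disjoint S hS, card_product, card_powersetCard, hS, ← sq] at htot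
      rw [← htot, Nat.add_sub_cancel_left]
      refine card_le_card (filter_subset_filter _ (product_subset_product ?_ ?_)) <;>
      · intro K hK
        obtain ⟨hK, hKS⟩ := mem_filter.1 hK
        exact mem_powersetCard.2 ⟨hKS, mem_powersetCard_univ.1 (h𝒪 hK)⟩
  refine (sum_le_sum hsplit).trans ?_
  rw [sum_add_distrib, sum_const, card_powersetCard, card_univ, Fintype.card_fin, smul_eq_mul]
  refine Nat.add_le_add_right ?_ _
  have h := sum_card_bipartiteAbove_eq_sum_card_bipartiteBelow
    (s := (𝒪 ×ˢ 𝒪).filter fun p => Disjoint p.1 p.2)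
    (t := powersetCard m (univ : Finset (Fin n))) (fun p S => p.1 ∪ p.2 ⊆ S)
  unfold bipartiteAbove bipartiteBelow at h
  rw [← h, sum_const_nat (m := (n - 2 * k).choose (m - 2 * k))]
  · refine Nat.mul_le_mul_right _ ((card_filter_le _ _).trans ?_)
    rw [card_product, sq]
  · rintro ⟨K, K'⟩ hp
    simp only [mem_filter, mem_product] at hp
    have hK := mem_powersetCard_univ.1 (h𝒪 hp.1.1)
    have hK' := mem_powersetCard_univ.1 (h𝒪 hp.1.2)
    have hc : (K ∪ K').card = 2 * k := by rw [card_union_of_disjoint hp.2, hK, hK', two_mul]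
    rw [card_filter_superset _ (hc.le.trans hkm), hc]

/-- The probability that two independent uniform `k`-subsets of an `n`-set are disjoint. -/
noncomputable def disjointRatio (k n : ℕ) : ℝ := ((n - k).choose k : ℝ) / (n.choose k : ℝ)

/-- Variance bound: the fraction of the `k`-subsets of a random `m`-set `S` that belong to `𝒪`
deviates from the density of `𝒪` by little in mean square, uniformly in `n ≥ m` and `𝒪`. -/
lemma sum_sq_deviation_le (h𝒪 : 𝒪 ⊆ powersetCard k univ) (hkm : 2 * k ≤ m) (hmn : m ≤ n) :
    ∑ S ∈ powersetCard m univ, (((𝒪.filter (· ⊆ S)).card : ℝ) / (m.choose k : ℝ) -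
        (𝒪.card : ℝ) / (n.choose k : ℝ)) ^ 2 ≤
      n.choose m * (((disjointRatio k n)⁻¹ - 1) + (1 - disjointRatio k m)) := by
  have h1 := sum_card_filter_subset h𝒪 (by omega : k ≤ m)
  have h2 := sum_sq_card_filter_subset_le h𝒪 hkm
  have e1 : n.choose m * m.choose k = n.choose k * (n - k).choose (m - k) :=
    Nat.choose_mul (by omega)
  have e2 : (n - k).choose (m - k) * (m - k).choose k =
      (n - k).choose k * (n - 2 * k).choose (m - 2 * k) := by
    rw [Nat.choose_mul (by omega)]; congr 2 <;> omega
  have hcb : m.choose k * (m - k).choose k ≤ m.choose k ^ 2 := by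
    rw [sq]; exact Nat.mul_le_mul_left _ (Nat.choose_le_choose _ (by omega))
  have hO : 𝒪.card ≤ n.choose k := by
    simpa using card_le_card h𝒪
  have hb : 0 < m.choose k := Nat.choose_pos (by omega)
  have he : 0 < n.choose k := Nat.choose_pos (by omega)
  have hf : 0 < (n - k).choose k := Nat.choose_pos (by omega)
  have ha : 0 < n.choose m := Nat.choose_pos hmn
  have hfe : (n - k).choose k ≤ n.choose k := Nat.choose_le_choose _ (by omega)
  have hcb' : (m - k).choose k ≤ m.choose k := Nat.choose_le_choose _ (by omega)
  have h1' : ∑ S ∈ powersetCard m univ, ((𝒪.filter (· ⊆ S)).card : ℝ) =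
      𝒪.card * (n - k).choose (m - k) := by exact_mod_cast h1
  have h2' : ∑ S ∈ powersetCard m univ, ((𝒪.filter (· ⊆ S)).card : ℝ) ^ 2 ≤
      𝒪.card ^ 2 * (n - 2 * k).choose (m - 2 * k) +
        n.choose m * (m.choose k ^ 2 - m.choose k * (m - k).choose k) := by
    have := (Nat.cast_le (α := ℝ)).2 h2
    push_cast [Nat.cast_sub hcb] at this
    exact this
  have hexp : ∑ S ∈ powersetCard m (univ : Finset (Fin n)),
      (((𝒪.filter (· ⊆ S)).card : ℝ) / (m.choose k : ℝ) -
        (𝒪.card : ℝ) / (n.choose k : ℝ)) ^ 2 =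
      (∑ S ∈ powersetCard m univ, ((𝒪.filter (· ⊆ S)).card : ℝ) ^ 2) / (m.choose k : ℝ) ^ 2
      - 2 * (∑ S ∈ powersetCard m univ, ((𝒪.filter (· ⊆ S)).card : ℝ)) *
          ((𝒪.card : ℝ) / n.choose k) / m.choose k
      + n.choose m * ((𝒪.card : ℝ) / n.choose k) ^ 2 := by
    have hc : (n.choose m : ℝ) * ((𝒪.card : ℝ) / n.choose k) ^ 2 =
        ∑ S ∈ powersetCard m (univ : Finset (Fin n)), ((𝒪.card : ℝ) / n.choose k) ^ 2 := by
      rw [sum_const, card_powersetCard, card_univ, Fintype.card_fin, nsmul_eq_mul]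
    rw [hc, sum_div, mul_sum, sum_mul, sum_div, ← sum_sub_distrib, ← sum_add_distrib]
    refine sum_congr rfl fun S _ => ?_
    ring
  rw [hexp, h1']
  unfold disjointRatio
  have E1 : (n.choose m : ℝ) * m.choose k = n.choose k * (n - k).choose (m - k) := by
    exact_mod_cast e1
  have E2 : ((n - k).choose (m - k) : ℝ) * (m - k).choose k =
      (n - k).choose k * (n - 2 * k).choose (m - 2 * k) := by exact_mod_cast e2
  have Hb : (0 : ℝ) < m.choose k := by exact_mod_cast hb
  have He : (0 : ℝ) < n.choose k := by exact_mod_cast he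
  have Hf : (0 : ℝ) < (n - k).choose k := by exact_mod_cast hf
  have Ha : (0 : ℝ) < n.choose m := by exact_mod_cast ha
  have HO : (𝒪.card : ℝ) ≤ n.choose k := by exact_mod_cast hO
  have Hcb : ((m - k).choose k : ℝ) ≤ m.choose k := by exact_mod_cast hcb'
  have Hfe : ((n - k).choose k : ℝ) ≤ n.choose k := by exact_mod_cast hfe
  have HO0 : (0 : ℝ) ≤ 𝒪.card := by positivity
  refine le_trans ?_ (second_moment_bound Ha Hb He Hf Hcb Hfe HO0 HO E1 E2 h2')
  refine le_of_eq ?_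
  have hg : ((n - k).choose (m - k) : ℝ) = n.choose m * m.choose k / n.choose k := by
    field_simp; linarith
  rw [hg]
  field_simp
  ring

end SetFamilies

lemma tendsto_disjointRatio (k : ℕ) :
    Filter.Tendsto (disjointRatio k) Filter.atTop (nhds 1) := by
  have hlow : Filter.Tendsto (fun n : ℕ => (1 - (2 * k : ℝ) / n) ^ k) Filter.atTop (nhds 1) := by
    have := ((tendsto_const_nhds (x := (1 : ℝ))).sub
      (tendsto_const_div_atTop_nhds_zero_nat (2 * k : ℝ))).pow k
    simpa using this
  refine tendsto_of_tendsto_of_tendsto_of_le_of_le' hlow tendsto_const_nhds ?_ ?_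
  · filter_upwards [Filter.eventually_ge_atTop (2 * k + 1)] with n hn
    have hn0 : (0 : ℝ) < n := by exact_mod_cast (by omega : 0 < n)
    unfold disjointRatio
    rw [le_div_iff₀ (by exact_mod_cast Nat.choose_pos (by omega : k ≤ n))]
    have h1 : (n - 2 * k) ^ k ≤ (n - k).descFactorial k :=
      (Nat.pow_le_pow_left (by omega) k).trans (Nat.pow_sub_le_descFactorial _ _)
    have h2 := Nat.descFactorial_le_pow n k
    rw [Nat.descFactorial_eq_factorial_mul_choose] at h1 h2
    have h1' : ((n : ℝ) - 2 * k) ^ k ≤ k.factorial * (n - k).choose k := by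
      have := (Nat.cast_le (α := ℝ)).2 h1
      push_cast [Nat.cast_sub (by omega : 2 * k ≤ n)] at this
      exact this
    have h2' : (k.factorial : ℝ) * n.choose k ≤ (n : ℝ) ^ k := by exact_mod_cast h2
    have hk : (0 : ℝ) < k.factorial := by exact_mod_cast Nat.factorial_pos k
    have hnk : (2 * k : ℝ) ≤ n := by exact_mod_cast (by omega : 2 * k ≤ n)
    have h3 : (1 - (2 * k : ℝ) / n) = (n - 2 * k) / n := by field_simp
    have h4 : 0 ≤ (1 - (2 * k : ℝ) / n) ^ k := by
      rw [h3]; exact pow_nonneg (div_nonneg (by linarith) hn0.le) k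
    refine le_of_mul_le_mul_left ?_ hk
    calc (k.factorial : ℝ) * ((1 - (2 * k : ℝ) / n) ^ k * n.choose k)
        = (1 - (2 * k : ℝ) / n) ^ k * (k.factorial * n.choose k) := by ring
      _ ≤ (1 - (2 * k : ℝ) / n) ^ k * n ^ k := by gcongr
      _ = ((n : ℝ) - 2 * k) ^ k := by rw [h3, ← mul_pow]; congr 1; field_simp
      _ ≤ _ := h1'
  · refine Filter.Eventually.of_forall fun n => ?_
    exact div_le_one_of_le₀ (by exact_mod_cast Nat.choose_le_choose _ (by omega)) (by positivity)

/-! ### Occurrences in an inflation -/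

open Classical in
/-- A map `b` into `σ` with `m` values factors uniquely as an increasing map after a surjection onto
`Fin m`. So the number of such maps with a property that depends only on the relative order of
positions and of values is determined by the counts of the patterns of order `m`. -/
lemma card_filter_card_image_eq {k m : ℕ} (σ : Permutation)
    (R : (Fin k → Fin k → Prop) → (Fin k → Fin k → Prop) → Prop) :
    (univ.filter fun b : Fin k → Fin σ.1 => (univ.image b).card = m ∧
        R (fun i j => b i < b j) (fun i j => σ.2 (b i) < σ.2 (b j))).card =
      ∑ ρ : Equiv.Perm (Fin m), (Occ ⟨m, ρ⟩ σ).card *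
        (univ.filter fun q : Fin k → Fin m => Function.Surjective q ∧
          R (fun i j => q i < q j) (fun i j => ρ (q i) < ρ (q j))).card := by
  obtain ⟨n, σ⟩ := σ
  simp_rw [← card_product]
  rw [← card_sigma]
  symm
  refine card_bij (fun x _ => x.2.1 ∘ x.2.2) ?_ ?_ ?_
  · rintro ⟨ρ, g, q⟩ h
    simp only [mem_sigma, mem_univ, true_and, mem_product, mem_filter] at h ⊢
    obtain ⟨hocc, hq, hR⟩ := h
    obtain ⟨hg, hρ⟩ := mem_Occ_mk.1 hocc
    constructor
    · rw [← image_image, image_univ_of_surjective hq, card_image_of_injective _ hg.injective,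
        card_univ, Fintype.card_fin]
    · convert hR using 3
      · exact hg.lt_iff_lt
      · exact (hρ _ _).symm
  · rintro ⟨ρ, g, q⟩ h ⟨ρ', g', q'⟩ h' heq
    simp only [mem_sigma, mem_univ, true_and, mem_product, mem_filter] at h h' heq
    have ho := mem_Occ_mk.1 h.1
    have ho' := mem_Occ_mk.1 h'.1
    obtain rfl : g = g' := by
      refine (ho.1.range_inj ho'.1).1 ?_
      rw [← h.2.1.range_comp, heq, h'.2.1.range_comp]
    obtain rfl : q = q' := funext fun i => ho.1.injective (congrFun heq i)
    obtain rfl : ρ = ρ' := (isOcc_iff.1 ho).2.trans (isOcc_iff.1 ho').2.symm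
    rfl
  · intro b hb
    simp only [mem_filter, mem_univ, true_and] at hb
    obtain ⟨hcard, hR⟩ := hb
    set g := (univ.image b).orderEmbOfFin hcard with hgdef
    have hg : StrictMono g := g.strictMono
    have : ∀ i, ∃ j, g j = b i := fun i => by
      have : b i ∈ Set.range g := by
        rw [hgdef, range_orderEmbOfFin]; simp
      exact this
    choose q hq using this
    have hqs : Function.Surjective q := fun j => by
      have : g j ∈ univ.image b := orderEmbOfFin_mem _ _ _
      obtain ⟨i, -, hi⟩ := mem_image.1 this
      exact ⟨i, hg.injective (by rw [hq, hi])⟩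
    have hocc : IsOcc (pattern (σ ∘ g)) σ g := isOcc_iff.2 ⟨hg, rfl⟩
    refine ⟨⟨pattern (σ ∘ g), g, q⟩, ?_, funext hq⟩
    simp only [mem_sigma, mem_univ, true_and, mem_product, mem_filter]
    refine ⟨mem_Occ_mk.2 hocc, hqs, ?_⟩
    convert hR using 3
    · rw [← hq, ← hq]; exact hg.lt_iff_lt.symm
    · rw [← hq, ← hq]; exact hocc.2 _ _

open Classical in
/-- The number of non-injective maps `b : Fin k → Fin |σ|` for which `R` holds of the strict order of
the positions `b i` and of the strict order of the values `σ (b i)`. -/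
noncomputable def noninjectiveCount {k : ℕ} (σ : Permutation)
    (R : (Fin k → Fin k → Prop) → (Fin k → Fin k → Prop) → Prop) : ℕ :=
  (univ.filter fun b : Fin k → Fin σ.1 => ¬ Function.Injective b ∧
    R (fun i j => b i < b j) (fun i j => σ.2 (b i) < σ.2 (b j))).card

/-- Non-injective maps have fewer than `k` values, so only patterns of order below `k` matter. -/
lemma noninjectiveCount_congr {k : ℕ} {σ π : Permutation}
    (h : ∀ ρ : Permutation, ρ.order < k → (Occ ρ σ).card = (Occ ρ π).card)
    (R : (Fin k → Fin k → Prop) → (Fin k → Fin k → Prop) → Prop) :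
    noninjectiveCount σ R = noninjectiveCount π R := by
  classical
  have key : ∀ υ : Permutation, noninjectiveCount υ R =
      ∑ m ∈ range k, (univ.filter fun b : Fin k → Fin υ.1 => (univ.image b).card = m ∧
        R (fun i j => b i < b j) (fun i j => υ.2 (b i) < υ.2 (b j))).card := by
    intro υ
    have hinj : ∀ b : Fin k → Fin υ.1, ¬ Function.Injective b ↔ (univ.image b).card < k := by
      intro b
      have hle : (univ.image b).card ≤ k := by simpa using card_image_le (s := univ) (f := b)
      have hiff : (univ.image b).card = k ↔ Function.Injective b := by
        simpa using card_image_iff (s := univ) (f := b)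
      rw [← hiff]; omega
    unfold noninjectiveCount
    rw [card_eq_sum_card_fiberwise (f := fun b => (univ.image b).card) (t := range k)]
    · refine sum_congr rfl fun m hm => ?_
      congr 1
      ext b
      have := mem_range.1 hm
      simp only [mem_filter, mem_univ, true_and, hinj]
      constructor
      · rintro ⟨⟨-, hR⟩, rfl⟩; exact ⟨rfl, hR⟩
      · rintro ⟨rfl, hR⟩; exact ⟨⟨this, hR⟩, rfl⟩
    · intro b hb
      simp only [coe_filter, mem_univ, true_and, Set.mem_ofPred_eq, hinj] at hb
      simpa using hb.1
  rw [key, key]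
  refine sum_congr rfl fun m hm => ?_
  rw [card_filter_card_image_eq, card_filter_card_image_eq]
  refine sum_congr rfl fun ρ _ => ?_
  rw [h ⟨m, ρ⟩ (mem_range.1 hm)]

/-- The inflation of `σ` by increasing blocks of length `N`: every point of `σ` is replaced by `N`
consecutive increasing points. `finProdFinEquiv` orders the pairs (block, offset)
lexicographically. -/
def inflatePerm {n : ℕ} (N : ℕ) (σ : Equiv.Perm (Fin n)) : Equiv.Perm (Fin (n * N)) :=
  finProdFinEquiv.symm.trans ((Equiv.prodCongr σ (Equiv.refl (Fin N))).trans finProdFinEquiv)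

lemma inflatePerm_apply {n : ℕ} (N : ℕ) (σ : Equiv.Perm (Fin n)) (b : Fin n) (r : Fin N) :
    inflatePerm N σ (finProdFinEquiv (b, r)) = finProdFinEquiv (σ b, r) := by
  simp [inflatePerm]

/-- `inflatePerm` for permutations bundled with their order. -/
def inflate (N : ℕ) (σ : Permutation) : Permutation :=
  ⟨σ.1 * N, inflatePerm N σ.2⟩

lemma finProdFinEquiv_lt {n N : ℕ} (x y : Fin n × Fin N) :
    finProdFinEquiv x < finProdFinEquiv y ↔ x.1 < y.1 ∨ x.1 = y.1 ∧ x.2 < y.2 := by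
  obtain ⟨a, r⟩ := x
  obtain ⟨b, s⟩ := y
  have hr := r.2
  have hs := s.2
  simp only [Fin.lt_def, finProdFinEquiv_apply_val, Fin.ext_iff]
  constructor
  · intro h
    rcases lt_trichotomy (a : ℕ) b with hab | hab | hab
    · exact Or.inl hab
    · rw [hab] at h
      exact Or.inr ⟨hab, by omega⟩
    · have := Nat.mul_le_mul_left N (Nat.succ_le_of_lt hab)
      rw [Nat.succ_eq_add_one, mul_add] at this
      omega
  · rintro (hab | ⟨hab, h⟩)
    · have := Nat.mul_le_mul_left N (Nat.succ_le_of_lt hab)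
      rw [Nat.succ_eq_add_one, mul_add] at this
      omega
    · rw [hab]; omega

/-- The map with offsets `r`, whose blocks have position order `A` and value order `B`, is an
occurrence of `τ` in an inflation. Two points lie in the same block when neither order relates
them. -/
def BlockRel {k N : ℕ} (τ : Equiv.Perm (Fin k)) (r : Fin k → Fin N)
    (A B : Fin k → Fin k → Prop) : Prop :=
  (∀ i j, i < j → A i j ∨ (¬ A i j ∧ ¬ A j i) ∧ r i < r j) ∧
    ∀ i j, τ i > τ j ↔ B j i ∨ (¬ B i j ∧ ¬ B j i) ∧ r j < r i

lemma isOcc_inflatePerm_iff {k n N : ℕ} (τ : Equiv.Perm (Fin k)) (σ : Equiv.Perm (Fin n))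
    (b : Fin k → Fin n) (r : Fin k → Fin N) :
    IsOcc τ (inflatePerm N σ) (fun i => finProdFinEquiv (b i, r i)) ↔
      BlockRel τ r (fun i j => b i < b j) (fun i j => σ (b i) < σ (b j)) := by
  have heq : ∀ {n : ℕ} (x y : Fin n), x = y ↔ ¬ x < y ∧ ¬ y < x := fun x y => by
    rw [not_lt, not_lt, le_antisymm_iff, and_comm]
  refine and_congr (forall₃_congr fun i j _ => ?_) (forall₂_congr fun i j => ?_)
  · simp only [finProdFinEquiv_lt]
    rw [heq]
  · simp only [inflatePerm_apply, gt_iff_lt, finProdFinEquiv_lt]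
    rw [heq, and_comm (a := ¬ σ (b j) < _)]

lemma isOcc_of_blockRel {k N : ℕ} (τ : Equiv.Perm (Fin k)) (σ : Permutation)
    {b : Fin k → Fin σ.1} (hb : Function.Injective b) (r : Fin k → Fin N) :
    BlockRel τ r (fun i j => b i < b j) (fun i j => σ.2 (b i) < σ.2 (b j)) ↔ IsOcc τ σ.2 b := by
  refine and_congr (forall₃_congr fun i j hij => ?_) (forall₂_congr fun i j => ?_)
  · have := hb.ne hij.ne
    refine or_iff_left fun h => this ?_
    exact le_antisymm (not_lt.1 h.1.2) (not_lt.1 h.1.1)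
  · refine iff_congr Iff.rfl (or_iff_left fun h => ?_)
    have : i = j := hb (σ.2.injective (le_antisymm (not_lt.1 h.1.2) (not_lt.1 h.1.1)))
    exact absurd h.2 (by rw [this]; exact lt_irrefl _)

open Classical in
/-- For each choice of offsets, the occurrences of `τ` in the inflation that use `|τ|` different
blocks are exactly the occurrences of `τ` in `σ`. -/
lemma card_Occ_inflate (N : ℕ) (τ σ : Permutation) :
    (Occ τ (inflate N σ)).card = N ^ τ.order * (Occ τ σ).card +
      ∑ r : Fin τ.1 → Fin N, noninjectiveCount σ (BlockRel τ.2 r) := by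
  have hN : N ^ τ.order * (Occ τ σ).card = ∑ r : Fin τ.1 → Fin N, (Occ τ σ).card := by
    simp [Permutation.order]
  rw [hN, ← sum_add_distrib]
  have hr : ∀ r : Fin τ.1 → Fin N, (Occ τ σ).card +
      noninjectiveCount σ (BlockRel τ.2 r) =
      (univ.filter fun b : Fin τ.1 → Fin σ.1 =>
        BlockRel τ.2 r (fun i j => b i < b j) (fun i j => σ.2 (b i) < σ.2 (b j))).card := by
    intro r
    rw [← card_filter_add_card_filter_not (s := univ.filter fun b : Fin τ.1 → Fin σ.1 =>
        BlockRel τ.2 r (fun i j => b i < b j) (fun i j => σ.2 (b i) < σ.2 (b j)))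
        Function.Injective]
    unfold noninjectiveCount
    congr 2
    · ext b
      simp only [mem_Occ, mem_filter, mem_univ, true_and]
      constructor
      · intro h
        exact ⟨(isOcc_of_blockRel _ _ h.1.injective r).2 h, h.1.injective⟩
      · rintro ⟨h, hb⟩
        exact (isOcc_of_blockRel _ _ hb r).1 h
    · ext b
      simp only [mem_filter, mem_univ, true_and, and_comm]
  simp_rw [hr]
  rw [← card_sigma]
  symm
  refine card_bij (fun x _ i => finProdFinEquiv (x.2 i, x.1 i)) ?_ ?_ ?_
  · rintro ⟨r, b⟩ h
    simp only [mem_sigma, mem_filter, mem_univ, true_and] at h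
    exact mem_Occ.2 ((isOcc_inflatePerm_iff _ _ _ _).2 h)
  · rintro ⟨r, b⟩ - ⟨r', b'⟩ - h
    have hi : ∀ i, b i = b' i ∧ r i = r' i := fun i => by
      have := finProdFinEquiv.injective (congrFun h i)
      simpa using this
    obtain rfl : b = b' := funext fun i => (hi i).1
    obtain rfl : r = r' := funext fun i => (hi i).2
    rfl
  · intro g hg
    have hgeq : (fun i => finProdFinEquiv ((finProdFinEquiv.symm (g i)).1,
        (finProdFinEquiv.symm (g i)).2)) = g := by
      funext i; exact finProdFinEquiv.apply_symm_apply (g i)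
    refine ⟨⟨fun i => (finProdFinEquiv.symm (g i)).2, fun i => (finProdFinEquiv.symm (g i)).1⟩,
      ?_, hgeq⟩
    simp only [mem_sigma, mem_filter, mem_univ, true_and]
    rw [← isOcc_inflatePerm_iff]
    have h := mem_Occ.1 hg
    rw [← hgeq] at h
    exact h

/-- If `σ` and `π` have the same counts of all patterns smaller than `τ`, inflation multiplies the
difference of the counts of `τ` by exactly `N ^ |τ|`, which is the order of magnitude of the number
of all `|τ|`-subsets. -/
lemma card_Occ_inflate_congr (N : ℕ) {σ π : Permutation} (τ : Permutation)
    (h : ∀ ρ : Permutation, ρ.order < τ.order → (Occ ρ σ).card = (Occ ρ π).card) :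
    ((Occ τ (inflate N σ)).card : ℝ) - (Occ τ (inflate N π)).card =
      N ^ τ.order * ((Occ τ σ).card - (Occ τ π).card) := by
  rw [card_Occ_inflate N τ σ, card_Occ_inflate N τ π,
    sum_congr rfl fun r _ => noninjectiveCount_congr (k := τ.1) h (BlockRel τ.2 r)]
  push_cast
  ring

/-! ### Pairs that agree on all small patterns -/

/-- Pigeonhole: the pattern counts up to order `k` take at most `(2 ^ n + 1) ^ M` values on
permutations of order `n`, with `M` independent of `n`, and this is eventually less than `n!`. -/
lemma exists_ne_card_Occ_eq (k : ℕ) : ∃ n : ℕ, ∃ σ π : Equiv.Perm (Fin n), σ ≠ π ∧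
    ∀ ρ : Permutation, ρ.order ≤ k → (Occ ρ ⟨n, σ⟩).card = (Occ ρ ⟨n, π⟩).card := by
  let I := Σ m : Fin (k + 1), Equiv.Perm (Fin m)
  have hlim := (FloorSemiring.tendsto_pow_div_factorial_atTop
    ((4 : ℝ) ^ Fintype.card I)).eventually_lt_const one_pos
  obtain ⟨n, hn, hn1⟩ := (hlim.and (eventually_ge_atTop 1)).exists
  rw [div_lt_one (by positivity)] at hn
  have hcard : (2 ^ n + 1) ^ Fintype.card I < n.factorial := by
    have h1 : 2 ^ n + 1 ≤ 4 ^ n := by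
      have h2 : (4 : ℕ) ^ n = 2 ^ n * 2 ^ n := by rw [← mul_pow]; norm_num
      have h3 : 2 ≤ 2 ^ n := Nat.le_self_pow (by omega) 2
      nlinarith
    calc (2 ^ n + 1) ^ Fintype.card I ≤ (4 ^ n) ^ Fintype.card I := Nat.pow_le_pow_left h1 _
      _ = (4 ^ Fintype.card I) ^ n := by rw [← pow_mul, ← pow_mul, mul_comm]
      _ < n.factorial := by exact_mod_cast hn
  let F : Equiv.Perm (Fin n) → I → Fin (2 ^ n + 1) := fun σ ρ =>
    ⟨(Occ ⟨ρ.1, ρ.2⟩ ⟨n, σ⟩).card,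
      Nat.lt_succ_of_le ((card_Occ_le _ _).trans (Nat.choose_le_two_pow _ _))⟩
  obtain ⟨σ, π, hne, hF⟩ := Fintype.exists_ne_map_eq_of_card_lt F (by
    rw [Fintype.card_fun, Fintype.card_fin, Fintype.card_perm, Fintype.card_fin]
    exact hcard)
  refine ⟨n, σ, π, hne, ?_⟩
  rintro ⟨m, ρ⟩ hρ
  exact congrArg Fin.val (congrFun hF ⟨⟨m, Nat.lt_succ_of_le hρ⟩, ρ⟩)

lemma exists_card_Occ_ne {n : ℕ} {σ π : Equiv.Perm (Fin n)} (h : σ ≠ π) :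
    (Occ ⟨n, σ⟩ ⟨n, σ⟩).card ≠ (Occ ⟨n, σ⟩ ⟨n, π⟩).card := by
  have h1 : (Occ ⟨n, σ⟩ ⟨n, σ⟩).card ≠ 0 := by
    refine card_ne_zero_of_mem (a := id) ?_
    exact mem_Occ_mk.2 ⟨strictMono_id, fun _ _ => Iff.rfl⟩
  have h2 : (Occ ⟨n, σ⟩ ⟨n, π⟩).card = 0 := by
    rw [card_eq_zero, eq_empty_iff_forall_notMem]
    intro g hg
    obtain ⟨hg, hocc⟩ := mem_Occ_mk.1 hg
    have hid : g = id := (hg.range_inj strictMono_id).1 (by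
      rw [(Finite.surjective_of_injective hg.injective).range_eq, Set.range_id])
    subst hid
    exact h (perm_eq_of_lt_iff fun i j => hocc j i)
  rwa [h2]

/-- There are arbitrarily large pairs of permutations with the same densities of all patterns smaller
than `τ`, whose densities of `τ` differ by at least `d`. The gap does not depend on the order. -/
def Separates (τ : Permutation) (d : ℝ) : Prop :=
  ∀ N : ℕ, ∃ σ π : Permutation, N ≤ σ.order ∧ N ≤ π.order ∧
    (∀ ρ : Permutation, ρ.order < τ.order → density ρ σ = density ρ π) ∧
    d ≤ |density τ σ - density τ π|

/-- Take a pair of permutations with equal counts up to order `k`, let `τ` be a smallest pattern on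
which it disagrees, and inflate. -/
lemma exists_separates (k : ℕ) :
    ∃ τ : Permutation, k < τ.order ∧ ∃ d : ℝ, 0 < d ∧ d ≤ 1 ∧ Separates τ d := by
  classical
  obtain ⟨n, σ, π, hne, heq⟩ := exists_ne_card_Occ_eq k
  have hex : ∃ m, ∃ ρ : Equiv.Perm (Fin m),
      (Occ ⟨m, ρ⟩ ⟨n, σ⟩).card ≠ (Occ ⟨m, ρ⟩ ⟨n, π⟩).card := ⟨n, σ, exists_card_Occ_ne hne⟩
  obtain ⟨τ, hτ⟩ := Nat.find_spec hex
  have hmin : ∀ ρ : Permutation, ρ.order < Nat.find hex →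
      (Occ ρ ⟨n, σ⟩).card = (Occ ρ ⟨n, π⟩).card := by
    rintro ⟨l, ρ⟩ hl
    by_contra hcon
    exact Nat.find_min hex hl ⟨ρ, hcon⟩
  generalize Nat.find hex = m at τ hτ hmin
  have hkm : k < m := by
    by_contra hcon
    exact hτ (heq ⟨m, τ⟩ (not_lt.1 hcon))
  have hmn : m ≤ n := by
    by_contra hcon
    have hz : n.choose m = 0 := Nat.choose_eq_zero_of_lt (not_le.1 hcon)
    have h1 := card_Occ_le ⟨m, τ⟩ ⟨n, σ⟩
    have h2 := card_Occ_le ⟨m, τ⟩ ⟨n, π⟩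
    simp only [Permutation.order, hz, Nat.le_zero] at h1 h2
    exact hτ (h1.trans h2.symm)
  have hn : 1 ≤ n := by omega
  have hn' : (1 : ℝ) ≤ n := by exact_mod_cast hn
  refine ⟨⟨m, τ⟩, hkm, 1 / (n : ℝ) ^ m, by positivity,
    div_le_one_of_le₀ (one_le_pow₀ hn') (by positivity), fun N => ?_⟩
  have hord : N ≤ n * (N + 1) := by nlinarith
  refine ⟨inflate (N + 1) ⟨n, σ⟩, inflate (N + 1) ⟨n, π⟩, hord, hord, fun ρ hρ => ?_, ?_⟩
  · have h := card_Occ_inflate_congr (N + 1) ρ fun ρ' hρ' => hmin ρ' (hρ'.trans hρ)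
    rw [hmin ρ hρ, sub_self, mul_zero, sub_eq_zero] at h
    rw [density_eq, density_eq, h]
    rfl
  · have h := card_Occ_inflate_congr (N + 1) ⟨m, τ⟩ hmin
    have hden : ∀ υ : Equiv.Perm (Fin n), density ⟨m, τ⟩ (inflate (N + 1) ⟨n, υ⟩) =
        ((Occ ⟨m, τ⟩ (inflate (N + 1) ⟨n, υ⟩)).card : ℝ) / ((n * (N + 1)).choose m : ℝ) :=
      fun υ => density_eq _ _
    rw [hden, hden, ← sub_div, h, abs_div, abs_mul, Nat.abs_cast, abs_of_nonneg (by positivity)]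
    have hmN : m ≤ n * (N + 1) := by nlinarith
    have hpos : (0 : ℝ) < ((n * (N + 1)).choose m : ℝ) := by
      exact_mod_cast Nat.choose_pos hmN
    have hle : ((n * (N + 1)).choose m : ℝ) ≤ (n : ℝ) ^ m * ((N + 1 : ℕ) : ℝ) ^ m := by
      rw [← mul_pow]
      exact_mod_cast Nat.choose_le_pow _ _
    -- Two distinct natural numbers differ by at least one.
    have hone : (1 : ℝ) ≤ |((Occ ⟨m, τ⟩ ⟨n, σ⟩).card : ℝ) - (Occ ⟨m, τ⟩ ⟨n, π⟩).card| := by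
      have : (1 : ℤ) ≤ |((Occ ⟨m, τ⟩ ⟨n, σ⟩).card : ℤ) - (Occ ⟨m, τ⟩ ⟨n, π⟩).card| :=
        Int.one_le_abs (sub_ne_zero.2 (by exact_mod_cast hτ))
      exact_mod_cast this
    rw [div_le_div_iff₀ (by positivity) hpos, one_mul]
    refine hle.trans ?_
    change (n : ℝ) ^ m * ((N + 1 : ℕ) : ℝ) ^ m ≤ ((N + 1 : ℕ) : ℝ) ^ m * _ * (n : ℝ) ^ m
    have hp : (0 : ℝ) ≤ ((N + 1 : ℕ) : ℝ) ^ m * (n : ℝ) ^ m := by positivity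
    nlinarith [mul_le_mul_of_nonneg_left hone hp]

lemma exists_separating_sequence : ∃ τ : ℕ → Permutation, ∃ d : ℕ → ℝ,
    (StrictMono fun j => (τ j).order) ∧
      ∀ j, 0 < d j ∧ d j ≤ 1 ∧ Separates (τ j) (d j) := by
  choose T hT d hd using exists_separates
  let φ : ℕ → ℕ := fun j => (fun k => (T k).order)^[j] 0
  refine ⟨fun j => T (φ j), fun j => d (φ j), ?_, fun j => hd _⟩
  refine strictMono_nat_of_lt_succ fun j => ?_
  have hφ : φ (j + 1) = (T (φ j)).order := Function.iterate_succ_apply' _ _ _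
  simpa only [hφ] using hT (φ (j + 1))

/-! ### Uniform approximability, sampling and testability -/

/-- Sampling changes a density by at most `η` on average, for all samples of large order `m`. -/
lemma eventually_sum_abs_density_sub_le (τ : Permutation) {η : ℝ} (hη : 0 < η) :
    ∀ᶠ m : ℕ in atTop, ∀ σ : Permutation, m ≤ σ.order →
      ∑ g ∈ strictMonos m σ.1, |density τ σ - density τ ⟨m, pattern (σ.2 ∘ g)⟩| ≤
        η * σ.order.choose m := by
  have hq := tendsto_disjointRatio τ.1
  have hq1 : ∀ᶠ n in atTop, 1 - disjointRatio τ.1 n < η ^ 2 / 2 :=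
    (tendsto_const_nhds.sub hq).eventually_lt_const (by rw [sub_self]; positivity)
  have hq2 : ∀ᶠ n in atTop, (disjointRatio τ.1 n)⁻¹ - 1 < η ^ 2 / 2 :=
    ((hq.inv₀ one_ne_zero).sub tendsto_const_nhds).eventually_lt_const
      (by rw [inv_one, sub_self]; positivity)
  obtain ⟨M, hM⟩ := eventually_atTop.1 hq2
  filter_upwards [hq1, eventually_ge_atTop M, eventually_ge_atTop (2 * τ.1)] with m hm hMm hkm σ hmσ
  have hdev := sum_sq_deviation_le (occSets_subset τ σ) hkm hmσ
  rw [← image_strictMonos, sum_image (image_injOn_strictMonos _ _)] at hdev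
  have hsq : ∑ g ∈ strictMonos m σ.1,
      (density τ σ - density τ ⟨m, pattern (σ.2 ∘ g)⟩) ^ 2 ≤ σ.order.choose m * η ^ 2 := by
    refine le_trans (le_of_eq ?_) (hdev.trans ?_)
    · refine sum_congr rfl fun g hg => ?_
      rw [density_eq, density_eq, card_Occ_pattern τ σ (mem_strictMonos.1 hg), card_occSets,
        ← neg_sub, neg_sq]
      rfl
    · refine mul_le_mul_of_nonneg_left ?_ (by positivity)
      have := hM σ.1 (hMm.trans hmσ)
      linarith
  -- The weighted inequality `2|x| ≤ x² / η + η` turns the second moment into a first moment.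
  have habs : ∀ x : ℝ, |x| ≤ x ^ 2 / (2 * η) + η / 2 := by
    intro x
    have h : x ^ 2 / (2 * η) + η / 2 - |x| = (|x| - η) ^ 2 / (2 * η) := by
      rw [← sq_abs x]; field_simp; ring
    have : 0 ≤ (|x| - η) ^ 2 / (2 * η) := by positivity
    linarith
  calc _ ≤ ∑ g ∈ strictMonos m σ.1,
        ((density τ σ - density τ ⟨m, pattern (σ.2 ∘ g)⟩) ^ 2 / (2 * η) + η / 2) :=
        sum_le_sum fun g _ => habs _
    _ = (∑ g ∈ strictMonos m σ.1,
        (density τ σ - density τ ⟨m, pattern (σ.2 ∘ g)⟩) ^ 2) / (2 * η) +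
          σ.order.choose m * (η / 2) := by
        rw [sum_add_distrib, sum_div, sum_const, card_strictMonos, nsmul_eq_mul]; rfl
    _ ≤ (σ.order.choose m * η ^ 2) / (2 * η) + σ.order.choose m * (η / 2) := by gcongr
    _ = η * σ.order.choose m := by field_simp; ring

/-- `f` is a uniform limit of finite linear combinations of pattern densities. The patterns are
listed by natural numbers, so a pattern may occur several times. -/
def UniformlyApproximated (f : PermParam) : Prop :=
  ∀ κ : ℝ, 0 < κ → ∃ A : Finset ℕ, ∃ w : ℕ → ℝ, ∃ τ : ℕ → Permutation,
    ∀ σ, |f σ - ∑ j ∈ A, w j * density (τ j) σ| ≤ κ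

lemma abs_sub_le_of_approx {f : PermParam} {A : Finset ℕ} {w : ℕ → ℝ} {τ : ℕ → Permutation} {κ : ℝ}
    (h : ∀ σ, |f σ - ∑ j ∈ A, w j * density (τ j) σ| ≤ κ) (σ π : Permutation) :
    |f σ - f π| ≤ 2 * κ + ∑ j ∈ A, |w j| * |density (τ j) σ - density (τ j) π| := by
  have hsum : |(∑ j ∈ A, w j * density (τ j) σ) - ∑ j ∈ A, w j * density (τ j) π| ≤
      ∑ j ∈ A, |w j| * |density (τ j) σ - density (τ j) π| := by
    rw [← sum_sub_distrib]
    refine (abs_sum_le_sum_abs _ _).trans (le_of_eq (sum_congr rfl fun j _ => ?_))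
    rw [← mul_sub, abs_mul]
  have h1 := abs_le.1 (h σ)
  have h2 := abs_le.1 (h π)
  have h3 := abs_le.1 hsum
  rw [abs_le]
  constructor <;> linarith [h1.1, h1.2, h2.1, h2.2, h3.1, h3.2]

lemma UniformlyApproximated.finitelyApproximable {f : PermParam} (hf : UniformlyApproximated f) :
    FinitelyApproximable f := by
  classical
  intro ε hε
  obtain ⟨A, w, τ, h⟩ := hf (ε / 4) (by positivity)
  set W : ℝ := ∑ j ∈ A, |w j| with hW
  have hW0 : 0 ≤ W := sum_nonneg fun _ _ => abs_nonneg _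
  refine ⟨ε / (4 * (W + 1)), by positivity, 0, A.image τ, fun σ π _ _ hd => ?_⟩
  have hsum : ∑ j ∈ A, |w j| * |density (τ j) σ - density (τ j) π| ≤
      W * (ε / (4 * (W + 1))) := by
    rw [hW, sum_mul]
    exact sum_le_sum fun j hj =>
      mul_le_mul_of_nonneg_left (hd _ (mem_image_of_mem τ hj)).le (abs_nonneg _)
  have hlt : W * (ε / (4 * (W + 1))) ≤ ε / 4 := by
    rw [← mul_div_assoc, div_le_div_iff₀ (by positivity) (by positivity)]
    nlinarith
  linarith [abs_sub_le_of_approx h σ π]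

lemma UniformlyApproximated.testable {f : PermParam} (hf : UniformlyApproximated f) :
    Testable f := by
  classical
  intro ε hε
  obtain ⟨A, w, τ, h⟩ := hf (ε ^ 2 / 4) (by positivity)
  set W : ℝ := ∑ j ∈ A, |w j| with hW
  have hW0 : 0 ≤ W := sum_nonneg fun _ _ => abs_nonneg _
  have hη : 0 < ε ^ 2 / (2 * (W + 1)) := by positivity
  obtain ⟨m, hm⟩ := ((eventually_all_finset A).2 fun j _ =>
    eventually_sum_abs_density_sub_le (τ j) hη).exists
  refine ⟨m, fun π => f ⟨m, π⟩, fun σ hσ => ?_⟩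
  have hC : (0 : ℝ) < σ.order.choose m := by exact_mod_cast Nat.choose_pos hσ
  have hmean : ∑ g ∈ strictMonos m σ.1, |f σ - f ⟨m, pattern (σ.2 ∘ g)⟩| ≤
      ε ^ 2 * σ.order.choose m := by
    calc _ ≤ ∑ g ∈ strictMonos m σ.1, (2 * (ε ^ 2 / 4) + ∑ j ∈ A, |w j| *
          |density (τ j) σ - density (τ j) ⟨m, pattern (σ.2 ∘ g)⟩|) :=
          sum_le_sum fun g _ => abs_sub_le_of_approx h _ _
      _ = σ.order.choose m * (2 * (ε ^ 2 / 4)) + ∑ j ∈ A, |w j| * ∑ g ∈ strictMonos m σ.1,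
          |density (τ j) σ - density (τ j) ⟨m, pattern (σ.2 ∘ g)⟩| := by
          rw [sum_add_distrib, sum_const, card_strictMonos, nsmul_eq_mul, sum_comm]
          simp_rw [mul_sum]
          rfl
      _ ≤ σ.order.choose m * (2 * (ε ^ 2 / 4)) +
          ∑ j ∈ A, |w j| * (ε ^ 2 / (2 * (W + 1)) * σ.order.choose m) := by
          gcongr with j hj
          exact hm j hj σ hσ
      _ = (ε ^ 2 / 2 + W / (W + 1) * (ε ^ 2 / 2)) * σ.order.choose m := by
          rw [← sum_mul, ← hW]; field_simp; ring
      _ ≤ (ε ^ 2 / 2 + 1 * (ε ^ 2 / 2)) * σ.order.choose m := by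
          gcongr
          exact div_le_one_of_le₀ (by linarith) (by linarith)
      _ = _ := by ring
  have hfilter : (univ.filter fun g : Fin m → Fin σ.1 =>
      ∃ π : Equiv.Perm (Fin m), IsOcc π σ.2 g ∧ |f σ - f ⟨m, π⟩| < ε) =
      (strictMonos m σ.1).filter fun g => |f σ - f ⟨m, pattern (σ.2 ∘ g)⟩| < ε := by
    ext g
    simp only [mem_filter, mem_univ, true_and, mem_strictMonos, isOcc_iff]
    constructor
    · rintro ⟨π, ⟨hg, rfl⟩, hπ⟩; exact ⟨hg, hπ⟩
    · rintro ⟨hg, hπ⟩; exact ⟨_, ⟨hg, rfl⟩, hπ⟩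
  have hprob : sampleProb σ m (fun π => |f σ - f ⟨m, π⟩| < ε) =
      (((strictMonos m σ.1).filter fun g =>
        |f σ - f ⟨m, pattern (σ.2 ∘ g)⟩| < ε).card : ℝ) / σ.order.choose m := by
    rw [← hfilter]
    unfold sampleProb
    congr!
  rw [hprob, le_div_iff₀ hC]
  have hsplit := card_filter_add_card_filter_not (s := strictMonos m σ.1)
    (fun g => |f σ - f ⟨m, pattern (σ.2 ∘ g)⟩| < ε)
  rw [card_strictMonos] at hsplit
  have hsplit' : (((strictMonos m σ.1).filter fun g =>
      |f σ - f ⟨m, pattern (σ.2 ∘ g)⟩| < ε).card : ℝ) + ((strictMonos m σ.1).filter fun g =>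
      ¬ |f σ - f ⟨m, pattern (σ.2 ∘ g)⟩| < ε).card = σ.order.choose m := by
    exact_mod_cast hsplit
  -- Markov's inequality for the sampled deviation.
  have hmarkov : (((strictMonos m σ.1).filter fun g =>
      ¬ |f σ - f ⟨m, pattern (σ.2 ∘ g)⟩| < ε).card : ℝ) * ε ≤ ε ^ 2 * σ.order.choose m := by
    refine le_trans ?_ hmean
    refine le_trans ?_ (sum_le_sum_of_subset_of_nonneg (filter_subset
      (fun g => ¬ |f σ - f ⟨m, pattern (σ.2 ∘ g)⟩| < ε) _) fun _ _ _ => abs_nonneg _)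
    rw [← nsmul_eq_mul]
    exact card_nsmul_le_sum _ _ _ fun g hg => not_lt.1 (mem_filter.1 hg).2
  have hbad : (((strictMonos m σ.1).filter fun g =>
      ¬ |f σ - f ⟨m, pattern (σ.2 ∘ g)⟩| < ε).card : ℝ) ≤ ε * σ.order.choose m :=
    le_of_mul_le_mul_right (by linarith) hε
  linarith

/-! ### The weighted density series -/

/-- Weights that decay so fast that all weights after the `j`-th sum up to at most
`weight d j * d j / 3`. -/
noncomputable def weight (d : ℕ → ℝ) (j : ℕ) : ℝ := (∏ i ∈ range j, d i) * (1 / 4) ^ j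

/-- The series of the densities of the patterns `τ j` with the weights `weight d j`. -/
noncomputable def weightedParam (d : ℕ → ℝ) (τ : ℕ → Permutation) : PermParam :=
  fun σ => ∑' j, weight d j * density (τ j) σ

lemma hasSum_geometric_quarter (a : ℝ) : HasSum (fun i : ℕ => a * (1 / 4) ^ i) (a * (4 / 3)) := by
  have h := (hasSum_geometric_of_lt_one (r := (1 / 4 : ℝ)) (by norm_num) (by norm_num)).mul_left a
  norm_num at h ⊢
  exact h

section Weights

variable {d : ℕ → ℝ}

lemma weight_pos (hd : ∀ j, 0 < d j) (j : ℕ) : 0 < weight d j :=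
  mul_pos (prod_pos fun i _ => hd i) (by positivity)

lemma weight_add_le (hd : ∀ j, 0 < d j) (hd1 : ∀ j, d j ≤ 1) (j i : ℕ) :
    weight d (i + j) ≤ weight d j * (1 / 4) ^ i := by
  have h1 : ∏ x ∈ range i, d (j + x) ≤ 1 := prod_le_one (fun x _ => (hd _).le) fun x _ => hd1 _
  have h0 := (weight_pos hd j).le
  rw [weight] at h0 ⊢
  rw [weight, add_comm i j, prod_range_add, pow_add]
  calc _ = (∏ x ∈ range i, d (j + x)) * (((∏ x ∈ range j, d x) * (1 / 4) ^ j) * (1 / 4) ^ i) := by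
        ring
    _ ≤ 1 * (((∏ x ∈ range j, d x) * (1 / 4) ^ j) * (1 / 4) ^ i) := by gcongr
    _ = _ := one_mul _

lemma weight_succ (j : ℕ) : weight d (j + 1) = weight d j * d j / 4 := by
  rw [weight, weight, prod_range_succ, pow_succ]; ring

/-- The tail of the series from index `j` on; summability is part of the statement, so that the sum
is not a junk value. -/
lemma abs_tsum_weight_mul_le (hd : ∀ j, 0 < d j) (hd1 : ∀ j, d j ≤ 1) {x : ℕ → ℝ}
    (hx : ∀ j, |x j| ≤ 1) (j : ℕ) :
    Summable (fun i => weight d (i + j) * x (i + j)) ∧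
      |∑' i, weight d (i + j) * x (i + j)| ≤ weight d j * (4 / 3) := by
  have hbound : ∀ i, ‖weight d (i + j) * x (i + j)‖ ≤ weight d j * (1 / 4) ^ i := fun i => by
    rw [Real.norm_eq_abs, abs_mul, abs_of_pos (weight_pos hd _)]
    calc _ ≤ weight d (i + j) * 1 := mul_le_mul_of_nonneg_left (hx _) (weight_pos hd _).le
      _ ≤ _ := by rw [mul_one]; exact weight_add_le hd hd1 j i
  exact ⟨Summable.of_norm_bounded (hasSum_geometric_quarter _).summable hbound,
    tsum_of_norm_bounded (hasSum_geometric_quarter _) hbound⟩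

lemma abs_density_le_one (τ σ : Permutation) : |density τ σ| ≤ 1 :=
  abs_le.2 ⟨by linarith [density_nonneg τ σ], density_le_one τ σ⟩

lemma weightedParam_isBounded (hd : ∀ j, 0 < d j) (hd1 : ∀ j, d j ≤ 1) (τ : ℕ → Permutation) :
    IsBounded (weightedParam d τ) :=
  ⟨weight d 0 * (4 / 3), fun σ =>
    (abs_tsum_weight_mul_le hd hd1 (fun j => abs_density_le_one (τ j) σ) 0).2⟩

lemma weightedParam_uniformlyApproximated (hd : ∀ j, 0 < d j) (hd1 : ∀ j, d j ≤ 1)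
    (τ : ℕ → Permutation) : UniformlyApproximated (weightedParam d τ) := by
  intro κ hκ
  have hlim : Tendsto (fun j : ℕ => (1 / 4 : ℝ) ^ j * (4 / 3)) atTop (nhds 0) := by
    simpa using (tendsto_pow_atTop_nhds_zero_of_lt_one (r := (1 / 4 : ℝ)) (by norm_num)
      (by norm_num)).mul_const (4 / 3 : ℝ)
  obtain ⟨j, hj⟩ := (hlim.eventually_lt_const hκ).exists
  refine ⟨range j, weight d, τ, fun σ => ?_⟩
  have h0 := (abs_tsum_weight_mul_le hd hd1 (fun j => abs_density_le_one (τ j) σ) 0).1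
  simp only [add_zero] at h0
  have ht := abs_tsum_weight_mul_le hd hd1 (fun j => abs_density_le_one (τ j) σ) j
  have hw : weight d j ≤ (1 / 4) ^ j := by simpa [weight] using weight_add_le hd hd1 0 j
  rw [weightedParam, ← h0.sum_add_tsum_nat_add j, add_sub_cancel_left]
  exact ht.2.trans (le_trans (mul_le_mul_of_nonneg_right hw (by norm_num)) hj.le)

/-- If `τ j` is the first pattern of the sequence on which `σ` and `π` differ, and they differ there
by at least `d j`, the later terms cannot cancel the `j`-th one. -/
lemma le_abs_weightedParam_sub (hd : ∀ j, 0 < d j) (hd1 : ∀ j, d j ≤ 1) {τ : ℕ → Permutation}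
    {j : ℕ} {σ π : Permutation} (heq : ∀ i < j, density (τ i) σ = density (τ i) π)
    (hj : d j ≤ |density (τ j) σ - density (τ j) π|) :
    weight d j * d j * (2 / 3) ≤ |weightedParam d τ σ - weightedParam d τ π| := by
  have hσ := (abs_tsum_weight_mul_le hd hd1 (fun j => abs_density_le_one (τ j) σ) 0).1
  have hπ := (abs_tsum_weight_mul_le hd hd1 (fun j => abs_density_le_one (τ j) π) 0).1
  simp only [add_zero] at hσ hπ
  have hx : ∀ i, |density (τ i) σ - density (τ i) π| ≤ 1 := fun i =>
    abs_le.2 ⟨by linarith [density_nonneg (τ i) σ, density_le_one (τ i) π],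
      by linarith [density_nonneg (τ i) π, density_le_one (τ i) σ]⟩
  have h0 := abs_tsum_weight_mul_le hd hd1 hx 0
  have ht := (abs_tsum_weight_mul_le hd hd1 hx (j + 1)).2
  have hdiff : weightedParam d τ σ - weightedParam d τ π =
      weight d j * (density (τ j) σ - density (τ j) π) +
        ∑' i, weight d (i + (j + 1)) *
          (density (τ (i + (j + 1))) σ - density (τ (i + (j + 1))) π) := by
    rw [weightedParam, weightedParam, ← hσ.tsum_sub hπ]
    simp only [← mul_sub]
    have hs := h0.1
    simp only [add_zero] at hs
    rw [← hs.sum_add_tsum_nat_add (j + 1), sum_range_succ, sum_eq_zero, zero_add]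
    intro i hi
    rw [heq i (mem_range.1 hi), sub_self, mul_zero]
  have hmain : weight d j * d j ≤ |weight d j * (density (τ j) σ - density (τ j) π)| := by
    rw [abs_mul, abs_of_pos (weight_pos hd j)]
    exact mul_le_mul_of_nonneg_left hj (weight_pos hd j).le
  rw [weight_succ] at ht
  rw [hdiff]
  refine le_trans ?_ (abs_sub_abs_le_abs_add _ _)
  linarith

end Weights

/-- A finite family only involves patterns smaller than some `τ j`, and the pairs separated by `τ j`
agree on all of these. -/
lemma not_finitelyForcible_weightedParam {d : ℕ → ℝ} {τ : ℕ → Permutation}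
    (hτ : StrictMono fun j => (τ j).order) (hd : ∀ j, 0 < d j) (hd1 : ∀ j, d j ≤ 1)
    (hsep : ∀ j, Separates (τ j) (d j)) : ¬ FinitelyForcible (weightedParam d τ) := by
  rintro ⟨A, hA⟩
  set j := A.sup Permutation.order + 1 with hj
  have hε : 0 < weight d j * d j * (2 / 3) :=
    mul_pos (mul_pos (weight_pos hd j) (hd j)) (by norm_num)
  obtain ⟨n₀, δ, hδ, h⟩ := hA _ hε
  obtain ⟨σ, π, hσ, hπ, heq, hne⟩ := hsep j n₀
  refine (h σ π hσ hπ fun ρ hρ => ?_).not_ge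
    (le_abs_weightedParam_sub hd hd1 (fun i hi => heq _ (hτ hi)) hne)
  have hle : ρ.order ≤ A.sup Permutation.order := le_sup (f := Permutation.order) hρ
  have hlt : ρ.order < (τ j).order := by
    have := hτ.le_apply (x := j)
    omega
  rwa [heq ρ hlt, sub_self, abs_zero]

end PermTesting

theorem theorem2 :
    ∃ f : PermTesting.PermParam,
      PermTesting.IsBounded f ∧
      PermTesting.FinitelyApproximable f ∧
      PermTesting.Testable f ∧
      ¬ PermTesting.FinitelyForcible f := by
  obtain ⟨τ, d, hτ, h⟩ := PermTesting.exists_separating_sequence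
  have hd : ∀ j, 0 < d j := fun j => (h j).1
  have hd1 : ∀ j, d j ≤ 1 := fun j => (h j).2.1
  have happrox := PermTesting.weightedParam_uniformlyApproximated hd hd1 τ
  exact ⟨PermTesting.weightedParam d τ, PermTesting.weightedParam_isBounded hd hd1 τ,
    happrox.finitelyApproximable, happrox.testable,
    PermTesting.not_finitelyForcible_weightedParam hτ hd hd1 fun j => (h j).2.2⟩
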